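/- A \emph{discrete filtered set} is a family $\Omega=(\Omega_L)_{L\in\mathbb{R}_{\ge0}}$ of finite subsets of $\mathbb{C}$ such that $\Omega_{L_1}\subseteq\Omega_{L_2}$ for $L_1\le L_2$ and $\Omega_\delta=\emptyset$ for some $\delta>0$. Fix one, let $\mathcal{S}_\Omega=\{(\lambda,\omega)\in\mathbb{R}_{\ge0}\times\mathbb{C}\mid\omega\in\Omega_\lambda\}$, and let $\mathcal{M}_\Omega=(\mathbb{R}_{\ge0}\times\mathbb{C})\setminus\overline{\mathcal{S}_\Omega}$, the closure being taken in $\mathbb{R}_{\ge0}\times\mathbb{C}$. A Lipschitz path $\gamma\colon[0,t_*]\to\mathbb{C}$ ($t_*\ge0$) with $\gamma(0)=0$ is \emph{$\Omega$-allowed} if $\big(L(\gamma|_{[0,t]}),\gamma(t)\big)\in\mathcal{M}_\Omega$ for all $t\in[0,t_*]$, where $L$ denotes the length of a path. An \emph{$\Omega$-endless Riemann surface} is a triple $(X,\mathfrak{p},\underline{0})$ where $X$ is a connected Riemann surface, $\mathfrak{p}\colon X\to\mathbb{C}$ is a local biholomorphism, $\underline{0}\in\mathfrak{p}^{-1}(0)$,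 and every $\Omega$-allowed path $\gamma\colon[0,t_*]\to\mathbb{C}$ has a continuous lift $\underline{\gamma}\colon[0,t_*]\to X$ with $\mathfrak{p}\circ\underline{\gamma}=\gamma$ and $\underline{\gamma}(0)=\underline{0}$. \textbf{Proposition.} There exists an $\Omega$-endless Riemann surface $(X_\Omega,\mathfrak{p}_\Omega,\underline{0}_\Omega)$ that is cofinal: for every $\Omega$-endless Riemann surface $(\tilde X,\tilde{\mathfrak{p}},\tilde{\underline{0}})$ there is a local biholomorphism $\mathfrak{q}\colon X_\Omega\to\tilde X$ with $\mathfrak{q}(\underline{0}_\Omega)=\tilde{\underline{0}}$ and $\tilde{\mathfrak{p}}\circ\mathfrak{q}=\mathfrak{p}_\Omega$. It is unique up to isomorphism: for every cofinal $\Omega$-endless Riemann surface $(X',\mathfrak{p}',\underline{0}')$ there is a biholomorphism $\Phi\colon X_\Omega\to X'$ with $\Phi(\underline{0}_\Omega)=\underline{0}'$ and $\mathfrak{p}'\circ\Phi=\mathfrak{p}_\Omega$. Moreover, $X_\Omega$ is simply connected. -/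

import Mathlib

open Set Topology
open scoped NNReal ENNReal Manifold ContDiff

universe u

/-- A discrete filtered set: a nondecreasing family of finite subsets of `ℂ` indexed by `ℝ≥0`,
one of which has positive index and is empty. -/
structure DiscreteFilteredSet where
  /-- the set `Ω_L` -/
  level : ℝ≥0 → Set ℂ
  finite_level : ∀ L, (level L).Finite
  level_subset : ∀ L₁ L₂, L₁ ≤ L₂ → level L₁ ⊆ level L₂
  exists_level_eq_empty : ∃ δ : ℝ≥0, 0 < δ ∧ level δ = ∅

namespace DiscreteFilteredSet

/-- The set of all `(λ, ω)` with `ω ∈ Ω_λ`. -/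
def singularSet (Ω : DiscreteFilteredSet) : Set (ℝ≥0 × ℂ) :=
  {x | x.2 ∈ Ω.level x.1}

/-- The allowed open set: the complement of the closure of `singularSet` in `ℝ≥0 × ℂ`. -/
def allowedSet (Ω : DiscreteFilteredSet) : Set (ℝ≥0 × ℂ) :=
  (closure Ω.singularSet)ᶜ

/-- The length of the restriction of `γ` to `[0, t]`. It is finite whenever `γ` is Lipschitz on
`[0, t]`, which is the only case in which it is used. -/
noncomputable def pathLength (γ : ℝ → ℂ) (t : ℝ) : ℝ≥0 :=
  (eVariationOn γ (Icc 0 t)).toNNReal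

/-- `γ`, restricted to `[0, T]`, is an `Ω`-allowed path: it is Lipschitz, starts at `0`, and
`(L(γ|[0,t]), γ t)` stays in the allowed open set. The values of `γ` off `[0, T]` play no role. -/
structure IsAllowedPath (Ω : DiscreteFilteredSet) (T : ℝ) (γ : ℝ → ℂ) : Prop where
  nonneg : 0 ≤ T
  lipschitz : ∃ K : ℝ≥0, LipschitzOnWith K γ (Icc 0 T)
  start : γ 0 = 0
  mem_allowedSet : ∀ t ∈ Icc 0 T, (pathLength γ t, γ t) ∈ Ω.allowedSet

end DiscreteFilteredSet

/-- An `Ω`-endless Riemann surface `(X, p, 0)`: a connected Riemann surface `X` (a connected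
Hausdorff complex manifold of dimension one), a local biholomorphism `p : X → ℂ`, and a point of
`X` above `0` from which every `Ω`-allowed path lifts to a continuous path in `X`. -/
structure EndlessRiemannSurface (Ω : DiscreteFilteredSet) where
  carrier : Type u
  [topologicalSpace : TopologicalSpace carrier]
  [chartedSpace : ChartedSpace ℂ carrier]
  [isManifold : IsManifold 𝓘(ℂ) ω carrier]
  [t2Space : T2Space carrier]
  [connectedSpace : ConnectedSpace carrier]
  proj : carrier → ℂ
  isLocalDiffeomorph_proj : IsLocalDiffeomorph 𝓘(ℂ) 𝓘(ℂ) ω proj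
  base : carrier
  proj_base : proj base = 0
  exists_lift : ∀ (T : ℝ) (γ : ℝ → ℂ), Ω.IsAllowedPath T γ →
    ∃ Γ : ℝ → carrier, ContinuousOn Γ (Icc 0 T) ∧ Γ 0 = base ∧ ∀ t ∈ Icc 0 T, proj (Γ t) = γ t

namespace EndlessRiemannSurface

attribute [instance] topologicalSpace chartedSpace isManifold t2Space connectedSpace

variable {Ω : DiscreteFilteredSet}

/-- `q` is a local biholomorphism compatible with the projections and the base points. -/
structure IsMorphism (X Y : EndlessRiemannSurface.{u} Ω) (q : X.carrier → Y.carrier) : Prop where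
  isLocalDiffeomorph : IsLocalDiffeomorph 𝓘(ℂ) 𝓘(ℂ) ω q
  map_base : q X.base = Y.base
  proj_comp : Y.proj ∘ q = X.proj

/-- `X` is cofinal: it maps to every `Ω`-endless Riemann surface. -/
def IsCofinal (X : EndlessRiemannSurface.{u} Ω) : Prop :=
  ∀ Y : EndlessRiemannSurface.{u} Ω, ∃ q : X.carrier → Y.carrier, IsMorphism X Y q

/-- `X` and `Y` are isomorphic: there is a biholomorphism between them that is compatible with
the projections and the base points. -/
def IsIsomorphic (X Y : EndlessRiemannSurface.{u} Ω) : Prop :=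
  ∃ Φ : Diffeomorph 𝓘(ℂ) 𝓘(ℂ) X.carrier Y.carrier ω,
    Φ X.base = Y.base ∧ Y.proj ∘ Φ = X.proj

end EndlessRiemannSurface

/-! Two allowed paths are identified if they have the same end point and their lifts to every
endless surface have the same end point. The space of classes gets a local homeomorphism to the
plane by continuing a path along short segments, which is possible because the allowed set is open,
and lifting is by construction a map from it to any endless surface. Hence it is cofinal.
A lift from a connected space to a Hausdorff space over the plane is determined by one of its
values, so morphisms between two cofinal surfaces are inverse to each other.
The universal cover of a cofinal surface is again endless, because paths lift further to it.
Cofinality therefore yields a section of the universal cover, and a connected space with such a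
section is simply connected.

All of this works over any normed space, for any class of paths closed under truncation and under
continuation along short segments. Over `ℂ`, the projection provides the holomorphic charts.
-/

universe v

open Filter

/-! ### Étale topologies -/

/-- A family of germs of sections of `p : E → B`, one through every point of `E`, such that the
germs along a section are those of the section itself. The value of `s e` matters only near
`p e`. -/
structure IsGermFamily {E B : Type*} [TopologicalSpace B] (p : E → B) (s : E → B → E) : Prop where
  self : ∀ e, s e (p e) = e
  proj : ∀ e, ∀ᶠ w in 𝓝 (p e), p (s e w) = w
  coherent : ∀ e, ∀ᶠ w in 𝓝 (p e), ∀ᶠ v in 𝓝 w, s (s e w) v = s e v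

/-- The étale topology defined by a family of germs of sections. -/
@[reducible] def etaleTopology {E B : Type*} [TopologicalSpace B] (p : E → B) (s : E → B → E) :
    TopologicalSpace E :=
  TopologicalSpace.mkOfNhds fun e => map (s e) (𝓝 (p e))

namespace IsGermFamily

variable {E B : Type*} [TopologicalSpace B] {p : E → B} {s : E → B → E}

theorem nhds_eq (h : IsGermFamily p s) (e : E) :
    @nhds E (etaleTopology p s) e = map (s e) (𝓝 (p e)) := by
  refine TopologicalSpace.nhds_mkOfNhds _ _ (fun a => ?_) fun a S hS => ?_
  · intro S hS
    have hmem := mem_of_mem_nhds (mem_map.1 hS)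
    rwa [mem_preimage, h.self] at hmem
  · rw [eventually_map]
    filter_upwards [h.proj a, h.coherent a, eventually_eventually_nhds.2 (mem_map.1 hS)]
      with w hw hw' hS'
    rw [mem_map, hw]
    filter_upwards [hw', hS'] with v hv hv'
    rw [mem_preimage, hv]
    exact hv'

theorem isLocalHomeomorph (h : IsGermFamily p s) :
    @IsLocalHomeomorph E B (etaleTopology p s) _ p := by
  let := etaleTopology p s
  have hmap (e : E) : map p (𝓝 e) = 𝓝 (p e) := by
    rw [h.nhds_eq, map_map]
    exact (map_congr (h.proj e)).trans map_id
  have hcont : Continuous p := continuous_iff_continuousAt.2 fun e => (hmap e).le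
  have hopen : IsOpenMap p := isOpenMap_iff_nhds_le.2 fun e => (hmap e).ge
  refine isLocalHomeomorph_iff_isOpenEmbedding_restrict.2 fun e => ?_
  have hU : s e '' {w | p (s e w) = w} ∈ 𝓝 e := by
    rw [h.nhds_eq]
    exact image_mem_map (h.proj e)
  refine ⟨interior _, interior_mem_nhds.2 hU, .of_continuous_injective_isOpenMap
    (hcont.comp continuous_subtype_val) ?_ (hopen.domRestrict isOpen_interior)⟩
  rintro ⟨x, hx⟩ ⟨y, hy⟩ hxy
  obtain ⟨v, hv, rfl⟩ := interior_subset hx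
  obtain ⟨w, hw, rfl⟩ := interior_subset hy
  have hvw : p (s e v) = p (s e w) := hxy
  rw [mem_ofPred_eq] at hv hw
  rw [hv, hw] at hvw
  subst hvw
  rfl

theorem continuousWithinAt {A : Type*} [TopologicalSpace A] (h : IsGermFamily p s) {f : A → E}
    {S : Set A} {a : A} (hf : ContinuousWithinAt (p ∘ f) S a)
    (hs : ∀ᶠ b in 𝓝[S] a, f b = s (f a) (p (f b))) :
    @ContinuousWithinAt A E _ (etaleTopology p s) f S a := by
  let := etaleTopology p s
  rw [ContinuousWithinAt, h.nhds_eq]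
  have : Tendsto (s (f a) ∘ p ∘ f) (𝓝[S] a) (map (s (f a)) (𝓝 (p (f a)))) :=
    tendsto_map.comp hf
  exact this.congr' (hs.mono fun b hb => hb.symm)

theorem continuousAt_iff {F : Type*} [TopologicalSpace F] (h : IsGermFamily p s) {f : E → F}
    {e : E} : @ContinuousAt E F (etaleTopology p s) _ f e ↔
      Tendsto (fun w => f (s e w)) (𝓝 (p e)) (𝓝 (f e)) := by
  let := etaleTopology p s
  rw [ContinuousAt, h.nhds_eq, tendsto_map'_iff]
  rfl

end IsGermFamily

/-- The charted space structure for which the restrictions of a local homeomorphism are charts. -/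
@[reducible] noncomputable def chartedSpaceOfIsLocalHomeomorph {X H : Type*} [TopologicalSpace X]
    [TopologicalSpace H] {p : X → H} (hp : IsLocalHomeomorph p) : ChartedSpace H X where
  atlas := {e | p = e}
  chartAt x := (hp x).choose
  mem_chart_source x := (hp x).choose_spec.1
  chart_mem_atlas x := (hp x).choose_spec.2

/-! ### The universal cover -/

/-- Semilocal simple connectedness, the condition under which homotopy classes of paths form a
covering space: every point has a neighbourhood in which any two paths with the same end points
are homotopic in the whole space. -/
class SemilocallySimplyConnectedSpace (X : Type*) [TopologicalSpace X] : Prop where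
  exists_nhds_homotopic (x : X) : ∃ U ∈ 𝓝 x, ∀ ⦃y z : X⦄ (α β : Path y z),
    range α ⊆ U → range β ⊆ U → α.Homotopic β

theorem semilocallySimplyConnectedSpace_of_nhds {X : Type*} [TopologicalSpace X]
    (h : ∀ x : X, ∃ U ∈ 𝓝 x, SimplyConnectedSpace U) : SemilocallySimplyConnectedSpace X where
  exists_nhds_homotopic x := by
    obtain ⟨U, hU, hsc⟩ := h x
    refine ⟨U, hU, fun y z α β hα hβ => ?_⟩
    let codRestrict (γ : Path y z) (hγ : range γ ⊆ U) :
        Path (⟨y, hα ⟨0, α.source⟩⟩ : U) ⟨z, hα ⟨1, α.target⟩⟩ :=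
      { toFun t := ⟨γ t, hγ (mem_range_self t)⟩
        source' := Subtype.ext γ.source
        target' := Subtype.ext γ.target }
    exact (SimplyConnectedSpace.paths_homotopic (codRestrict α hα) (codRestrict β hβ)).map
      ⟨Subtype.val, continuous_subtype_val⟩

/-- The universal cover of a space with base point `b`, as the set of homotopy classes of paths
from `b`. Its projection is the end point. -/
structure UniversalCover {X : Type*} [TopologicalSpace X] (b : X) where
  proj : X
  homotopyClass : Path.Homotopic.Quotient b proj

namespace UniversalCover

variable {X : Type*} [TopologicalSpace X] {b : X}

theorem mk_eq_mk {x y : X} {α : Path b x} {β : Path b y} (hxy : x = y)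
    (h : α.Homotopic (β.cast rfl hxy)) : UniversalCover.mk x (.mk α) = ⟨y, .mk β⟩ := by
  subst hxy
  exact congrArg _ (Path.Homotopic.Quotient.eq.2 h)

/-- The base point of the universal cover: the class of the constant path. -/
def base (b : X) : UniversalCover b := ⟨b, .refl b⟩

/-- The continuation of a class of paths along a further path. -/
noncomputable def trans (e : UniversalCover b) {w : X} (γ : Path e.proj w) : UniversalCover b :=
  ⟨w, e.homotopyClass.trans (.mk γ)⟩

theorem trans_congr (e : UniversalCover b) {w : X} {γ δ : Path e.proj w} (h : γ.Homotopic δ) :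
    e.trans γ = e.trans δ := by
  rw [trans, Path.Homotopic.Quotient.eq.2 h, trans]

theorem trans_refl (e : UniversalCover b) : e.trans (.refl e.proj) = e := by
  rw [trans, Path.Homotopic.Quotient.mk_refl, Path.Homotopic.Quotient.trans_refl]

theorem trans_trans (e : UniversalCover b) {v w : X} (γ : Path e.proj w) (δ : Path w v) :
    (e.trans γ).trans δ = e.trans (γ.trans δ) := by
  simp only [trans, Path.Homotopic.Quotient.mk_trans, ← Path.Homotopic.Quotient.trans_assoc]

theorem trans_right_injective {x w : X} {a a' : Path.Homotopic.Quotient b x} (γ : Path x w)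
    (h : trans ⟨x, a⟩ γ = trans ⟨x, a'⟩ γ) : a = a' := by
  have := congrArg (·.trans (.symm (.mk γ))) (eq_of_heq (UniversalCover.mk.inj h).2)
  simpa using this

/-- The lift of a path, whose value at `t` is the class of the restriction to `[0, t]`. -/
def pathLift {x : X} (α : Path b x) (t : unitInterval) : UniversalCover b :=
  ⟨α t, .mk ((α.subpath 0 t).cast α.source.symm rfl)⟩

theorem pathLift_zero {x : X} (α : Path b x) : pathLift α 0 = base b :=
  mk_eq_mk α.source (by
    rw [show (α.subpath 0 0).cast α.source.symm rfl = (Path.refl b).cast rfl α.source by ext; simp])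

theorem pathLift_one {x : X} (α : Path b x) : pathLift α 1 = ⟨x, .mk α⟩ :=
  mk_eq_mk α.target (by rw [Path.subpath_zero_one]; rfl)

theorem pathLift_trans_subpath {x : X} (α : Path b x) (s t : unitInterval) :
    (pathLift α s).trans (α.subpath s t) = pathLift α t := by
  have H := Path.Homotopic.pathCast ⟨Path.Homotopy.subpathTransSubpath α 0 s t⟩ α.source.symm rfl
  exact congrArg (UniversalCover.mk (α t)) (Path.Homotopic.Quotient.eq.2 H)

section EtaleTopology

variable [SemilocallySimplyConnectedSpace X] [LocallyPathConnectedSpace X]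

variable (X) in
theorem exists_isOpen_isPathConnected_homotopic (x : X) : ∃ U : Set X, IsOpen U ∧ x ∈ U ∧
    IsPathConnected U ∧ ∀ ⦃y z : X⦄ (α β : Path y z), range α ⊆ U → range β ⊆ U →
      α.Homotopic β := by
  obtain ⟨U, hU, h⟩ := SemilocallySimplyConnectedSpace.exists_nhds_homotopic x
  have hx : x ∈ interior U := mem_interior_iff_mem_nhds.2 hU
  have hsub : pathComponentIn (interior U) x ⊆ U := pathComponentIn_subset.trans interior_subset
  exact ⟨pathComponentIn (interior U) x, isOpen_interior.pathComponentIn x,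
    mem_pathComponentIn_self hx, isPathConnected_pathComponentIn hx,
    fun y z α β hα hβ => h α β (hα.trans hsub) (hβ.trans hsub)⟩

/-- An open path connected neighbourhood in which paths with the same end points are homotopic. -/
def simpleNhd (x : X) : Set X := (exists_isOpen_isPathConnected_homotopic X x).choose

theorem isOpen_simpleNhd (x : X) : IsOpen (simpleNhd x) :=
  (exists_isOpen_isPathConnected_homotopic X x).choose_spec.1

theorem mem_simpleNhd (x : X) : x ∈ simpleNhd x :=
  (exists_isOpen_isPathConnected_homotopic X x).choose_spec.2.1

theorem simpleNhd_mem_nhds (x : X) : simpleNhd x ∈ 𝓝 x :=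
  (isOpen_simpleNhd x).mem_nhds (mem_simpleNhd x)

theorem joinedIn_simpleNhd {x w : X} (hw : w ∈ simpleNhd x) : JoinedIn (simpleNhd x) x w :=
  (exists_isOpen_isPathConnected_homotopic X x).choose_spec.2.2.1.joinedIn
    x (mem_simpleNhd x) w hw

theorem homotopic_of_range_subset_simpleNhd {x y z : X} {α β : Path y z}
    (hα : range α ⊆ simpleNhd x) (hβ : range β ⊆ simpleNhd x) : α.Homotopic β :=
  (exists_isOpen_isPathConnected_homotopic X x).choose_spec.2.2.2 α β hα hβ

open Classical in
/-- The germ of section of the universal cover through `e`: continue the path to nearby points. -/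
noncomputable def germ (e : UniversalCover b) (w : X) : UniversalCover b :=
  if hw : w ∈ simpleNhd e.proj then e.trans (joinedIn_simpleNhd hw).somePath else e

theorem germ_eq_trans {e : UniversalCover b} {w : X} {γ : Path e.proj w}
    (hγ : range γ ⊆ simpleNhd e.proj) : germ e w = e.trans γ := by
  have hw : w ∈ simpleNhd e.proj := hγ ⟨1, γ.target⟩
  rw [germ, dif_pos hw]
  exact e.trans_congr (homotopic_of_range_subset_simpleNhd
    (range_subset_iff.2 (joinedIn_simpleNhd hw).somePath_mem) hγ)

theorem exists_germ_eq_trans {x w : X} (hw : w ∈ simpleNhd x) :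
    ∃ γ : Path x w, range γ ⊆ simpleNhd x ∧
      ∀ a : Path.Homotopic.Quotient b x, germ ⟨x, a⟩ w = trans ⟨x, a⟩ γ :=
  have hγ := range_subset_iff.2 (joinedIn_simpleNhd hw).somePath_mem
  ⟨_, hγ, fun a => germ_eq_trans (e := ⟨x, a⟩) hγ⟩

theorem isGermFamily_germ : IsGermFamily (proj (b := b)) germ where
  self e := by
    rw [germ_eq_trans (γ := .refl e.proj) (by simpa using mem_simpleNhd e.proj), trans_refl]
  proj e := by
    filter_upwards [simpleNhd_mem_nhds e.proj] with w hw
    obtain ⟨γ, -, hγ⟩ := exists_germ_eq_trans (b := b) hw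
    exact congrArg proj (hγ e.homotopyClass)
  coherent e := by
    filter_upwards [(isOpen_simpleNhd e.proj).mem_nhds (mem_simpleNhd e.proj)] with w hw
    obtain ⟨γ, hγ, hγe⟩ := exists_germ_eq_trans (b := b) hw
    filter_upwards [pathComponentIn_mem_nhds
      (inter_mem ((isOpen_simpleNhd e.proj).mem_nhds hw) (simpleNhd_mem_nhds w))] with v hv
    obtain ⟨δ, hδ⟩ := hv
    have hrange := range_subset_iff.2 hδ
    rw [show germ e w = e.trans γ from hγe e.homotopyClass,
      germ_eq_trans (e := e.trans γ) (γ := δ) (hrange.trans inter_subset_right), trans_trans,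
      germ_eq_trans]
    rw [Path.trans_range]
    exact union_subset hγ (hrange.trans inter_subset_left)

noncomputable instance : TopologicalSpace (UniversalCover b) := etaleTopology proj germ

theorem isLocalHomeomorph_proj : IsLocalHomeomorph (proj (b := b)) :=
  isGermFamily_germ.isLocalHomeomorph

theorem isSeparatedMap_proj : IsSeparatedMap (proj (b := b)) := by
  rw [isSeparatedMap_iff_disjoint_nhds]
  rintro ⟨x, a⟩ ⟨x', a'⟩ hx hne
  obtain rfl : x = x' := hx
  rw [isGermFamily_germ.nhds_eq, isGermFamily_germ.nhds_eq]
  refine disjoint_of_disjoint_of_mem ?_ (image_mem_map (simpleNhd_mem_nhds x))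
    (image_mem_map (simpleNhd_mem_nhds x))
  rw [disjoint_left]
  rintro _ ⟨w, hw, rfl⟩ ⟨w', hw', heq⟩
  obtain ⟨γ, -, hγ⟩ := exists_germ_eq_trans (b := b) hw
  obtain ⟨γ', -, hγ'⟩ := exists_germ_eq_trans (b := b) hw'
  rw [hγ, hγ'] at heq
  obtain rfl : w' = w := congrArg proj heq
  rw [← hγ', hγ] at heq
  exact hne (congrArg _ (trans_right_injective γ heq).symm)

instance [T2Space X] : T2Space (UniversalCover b) := by
  refine ⟨fun e e' hne => ?_⟩
  by_cases h : e.proj = e'.proj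
  · exact isSeparatedMap_proj e e' h hne
  · exact separated_by_continuous isLocalHomeomorph_proj.continuous h

theorem continuous_pathLift {x : X} (α : Path b x) : Continuous (pathLift α) := by
  refine continuous_iff_continuousAt.2 fun s => ?_
  rw [← continuousWithinAt_univ]
  refine isGermFamily_germ.continuousWithinAt α.continuous.continuousWithinAt ?_
  have hα : ∀ᶠ t in 𝓝 s, α '' uIcc s t ⊆ simpleNhd (α s) := by
    filter_upwards [tendsto_smallSets_iff.1 (tendsto_const_nhds.uIcc tendsto_id) _
      (α.continuous.continuousAt.preimage_mem_nhds (simpleNhd_mem_nhds (α s)))] with t ht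
    exact image_subset_iff.2 ht
  rw [nhdsWithin_univ]
  filter_upwards [hα] with t ht
  rw [← pathLift_trans_subpath α s t]
  exact (germ_eq_trans ((α.range_subpath s t).trans_subset ht)).symm

theorem exists_continuousOn_lift {T : ℝ} (hT : 0 ≤ T) {γ : ℝ → X} (hγ : ContinuousOn γ (Icc 0 T))
    (h0 : γ 0 = b) : ∃ Γ : ℝ → UniversalCover b, ContinuousOn Γ (Icc 0 T) ∧ Γ 0 = base b ∧
      ∀ t ∈ Icc 0 T, (Γ t).proj = γ t := by
  have hmul (s : unitInterval) : T * s ∈ Icc 0 T :=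
    ⟨mul_nonneg hT s.2.1, mul_le_of_le_one_right hT s.2.2⟩
  let α : Path b (γ T) :=
    { toFun s := γ (T * s)
      continuous_toFun := hγ.comp_continuous (by fun_prop) hmul
      source' := by simp [h0]
      target' := by simp }
  refine ⟨fun t => pathLift α (projIcc 0 1 zero_le_one (t / T)), ?_, ?_, fun t ht => ?_⟩
  · exact ((continuous_pathLift α).comp
      (continuous_projIcc.comp (continuous_id.div_const T))).continuousOn
  · simp only [zero_div, projIcc_left]
    exact pathLift_zero α
  · have htT : t / T ∈ Icc (0 : ℝ) 1 := ⟨div_nonneg ht.1 hT, div_le_one_of_le₀ ht.2 hT⟩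
    change γ (T * (projIcc 0 1 zero_le_one (t / T) : ℝ)) = γ t
    rw [projIcc_of_mem _ htT, mul_div_cancel_of_imp' fun h => ?_]
    exact le_antisymm (h ▸ ht.2) ht.1

theorem joined_base (e : UniversalCover b) : Joined (base b) e := by
  obtain ⟨x, a⟩ := e
  obtain ⟨α, rfl⟩ := a.mk_surjective
  exact ⟨⟨⟨pathLift α, continuous_pathLift α⟩, pathLift_zero α, pathLift_one α⟩⟩

instance : PathConnectedSpace (UniversalCover b) where
  nonempty := ⟨base b⟩
  joined e e' := e.joined_base.symm.trans e'.joined_base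

theorem section_apply_eq_mk {s : X → UniversalCover b} (hs : Continuous s)
    (hproj : ∀ x, (s x).proj = x) (hbase : s b = base b) {x : X} (α : Path b x) :
    s x = ⟨x, .mk α⟩ := by
  have hlift : s ∘ α = pathLift α :=
    isSeparatedMap_proj.eq_of_comp_eq isLocalHomeomorph_proj.isLocallyInjective
      (hs.comp α.continuous) (continuous_pathLift α) (funext fun t => hproj (α t)) 0
      (by rw [Function.comp_apply, α.source, hbase, pathLift_zero])
  rw [← pathLift_one, ← hlift, Function.comp_apply, α.target]

theorem simplyConnectedSpace_of_section [ConnectedSpace X] {s : X → UniversalCover b}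
    (hs : Continuous s) (hproj : ∀ x, (s x).proj = x) (hbase : s b = base b) :
    SimplyConnectedSpace X := by
  have : PathConnectedSpace X := .of_locallyPathConnectedSpace
  refine simply_connected_iff_paths_homotopic'.2 ⟨this, fun {x y} γ δ => ?_⟩
  obtain ⟨α⟩ := PathConnectedSpace.joined b x
  have h := (section_apply_eq_mk hs hproj hbase (α.trans γ)).symm.trans
    (section_apply_eq_mk hs hproj hbase (α.trans δ))
  rw [← Path.Homotopic.Quotient.eq]
  have := congrArg (Path.Homotopic.Quotient.trans (.symm (.mk α)))
    (eq_of_heq (UniversalCover.mk.inj h).2)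
  simpa [← Path.Homotopic.Quotient.trans_assoc] using this

end EtaleTopology

end UniversalCover

section NormedSpace

variable {X E : Type*} [TopologicalSpace X] [NormedAddCommGroup E] [NormedSpace ℝ E] {p : X → E}

theorem locallyPathConnectedSpace_of_isLocalHomeomorph (hp : IsLocalHomeomorph p) :
    LocallyPathConnectedSpace X :=
  let := chartedSpaceOfIsLocalHomeomorph hp
  ChartedSpace.locallyPathConnectedSpace E X

theorem semilocallySimplyConnectedSpace_of_isLocalHomeomorph (hp : IsLocalHomeomorph p) :
    SemilocallySimplyConnectedSpace X := by
  refine semilocallySimplyConnectedSpace_of_nhds fun x => ?_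
  obtain ⟨e, hx, -⟩ := hp x
  obtain ⟨r, hr, hball⟩ := Metric.isOpen_iff.1 e.open_target _ (e.map_source hx)
  refine ⟨e.symm '' Metric.ball (e x) r, ?_, ?_⟩
  · have h := e.symm.image_mem_nhds (e.map_source hx) (Metric.ball_mem_nhds _ hr)
    rwa [e.left_inv hx] at h
  · have : ContractibleSpace (Metric.ball (e x) r) :=
      (convex_ball _ _).contractibleSpace ⟨_, Metric.mem_ball_self hr⟩
    have := (e.symm.homeomorphOfImageSubsetSource hball rfl).symm.contractibleSpace
    infer_instance

end NormedSpace

section appendSegment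

variable {E : Type*} [NormedAddCommGroup E] [NormedSpace ℝ E] {T : ℝ} {γ : ℝ → E} {w : E} {t : ℝ}

/-- The path `γ` on `[0, T]`, followed on `[T, T + 1]` by the segment from `γ T` to `w`. -/
noncomputable def appendSegment (T : ℝ) (γ : ℝ → E) (w : E) (t : ℝ) : E :=
  γ (min t T) + max (t - T) 0 • (w - γ T)

theorem appendSegment_of_le (h : t ≤ T) : appendSegment T γ w t = γ t := by
  simp [appendSegment, h]

theorem appendSegment_of_ge (h : T ≤ t) :
    appendSegment T γ w t = AffineMap.lineMap (γ T) w (t - T) := by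
  simp [appendSegment, h, AffineMap.lineMap_apply, add_comm]

theorem appendSegment_end : appendSegment T γ w (T + 1) = w := by
  simp [appendSegment_of_ge]

end appendSegment

/-! ### Endless spaces -/

/-- A class of paths `γ : [0, T] → E` with a common origin, closed under restriction to `[0, t]`
and under continuation along short segments. The values of `γ` off `[0, T]` are junk. -/
structure PathClass (E : Type*) [NormedAddCommGroup E] [NormedSpace ℝ E] where
  IsAllowed : ℝ → (ℝ → E) → Prop
  origin : E
  nonneg : ∀ {T γ}, IsAllowed T γ → 0 ≤ T
  continuousOn : ∀ {T γ}, IsAllowed T γ → ContinuousOn γ (Icc 0 T)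
  apply_zero : ∀ {T γ}, IsAllowed T γ → γ 0 = origin
  isAllowed_const : IsAllowed 0 fun _ => origin
  truncate : ∀ {T γ t}, IsAllowed T γ → t ∈ Icc 0 T → IsAllowed t γ
  eventually_appendSegment : ∀ {T γ}, IsAllowed T γ →
    ∀ᶠ w in 𝓝 (γ T), IsAllowed (T + 1) (appendSegment T γ w)

/-- An endless space for a class `P` of paths: a connected Hausdorff space `X` with a local
homeomorphism `X → E` and a base point from which every path of `P` lifts to `X`. The universe
of `X` is at least that of `E`, so that there is room for the space of classes of paths. -/
structure EndlessSpace {E : Type v} [NormedAddCommGroup E] [NormedSpace ℝ E] (P : PathClass E) where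
  carrier : Type max u v
  [topologicalSpace : TopologicalSpace carrier]
  [t2Space : T2Space carrier]
  [connectedSpace : ConnectedSpace carrier]
  proj : carrier → E
  isLocalHomeomorph_proj : IsLocalHomeomorph proj
  base : carrier
  proj_base : proj base = P.origin
  exists_lift : ∀ T γ, P.IsAllowed T γ →
    ∃ Γ : ℝ → carrier, ContinuousOn Γ (Icc 0 T) ∧ Γ 0 = base ∧ ∀ t ∈ Icc 0 T, proj (Γ t) = γ t

namespace EndlessSpace

attribute [instance] topologicalSpace t2Space connectedSpace

variable {E : Type v} [NormedAddCommGroup E] [NormedSpace ℝ E] {P : PathClass E}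

/-- A morphism of endless spaces: a continuous map compatible with the projections and the base
points. -/
structure IsMorphism (X Y : EndlessSpace.{u} P) (q : X.carrier → Y.carrier) : Prop where
  continuous : Continuous q
  map_base : q X.base = Y.base
  proj_comp : Y.proj ∘ q = X.proj

/-- An endless space is cofinal if it maps to every endless space. -/
def IsCofinal (X : EndlessSpace.{u} P) : Prop :=
  ∀ Y : EndlessSpace.{u} P, ∃ q : X.carrier → Y.carrier, IsMorphism X Y q

variable {X Y : EndlessSpace.{u} P}

theorem eqOn_of_proj_eqOn {A : Type*} [TopologicalSpace A] {S : Set A} (hS : IsPreconnected S)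
    {f g : A → Y.carrier} (hf : ContinuousOn f S) (hg : ContinuousOn g S)
    (h : EqOn (Y.proj ∘ f) (Y.proj ∘ g) S) {a : A} (ha : a ∈ S) (hfg : f a = g a) : EqOn f g S :=
  (T2Space.isSeparatedMap Y.proj).eqOn_of_comp_eqOn Y.isLocalHomeomorph_proj.isLocallyInjective hS
    hf hg h ha hfg

theorem IsMorphism.comp_eq_id {q : X.carrier → Y.carrier} {r : Y.carrier → X.carrier}
    (hq : IsMorphism X Y q) (hr : IsMorphism Y X r) : r ∘ q = id :=
  (T2Space.isSeparatedMap X.proj).eq_of_comp_eq X.isLocalHomeomorph_proj.isLocallyInjective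
    (hr.continuous.comp hq.continuous) continuous_id
    (by rw [← Function.comp_assoc, hr.proj_comp, hq.proj_comp, Function.comp_id]) X.base
    (by rw [Function.comp_apply, hq.map_base, hr.map_base, id])

theorem IsCofinal.exists_homeomorph (hX : X.IsCofinal) (hY : Y.IsCofinal) :
    ∃ Φ : X.carrier ≃ₜ Y.carrier, IsMorphism X Y Φ := by
  obtain ⟨q, hq⟩ := hX Y
  obtain ⟨r, hr⟩ := hY X
  exact ⟨⟨⟨q, r, congrFun (hq.comp_eq_id hr), congrFun (hr.comp_eq_id hq)⟩, hq.continuous,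
    hr.continuous⟩, hq⟩

section UniversalCover

variable (X)

instance : LocallyPathConnectedSpace X.carrier :=
  locallyPathConnectedSpace_of_isLocalHomeomorph X.isLocalHomeomorph_proj

instance : SemilocallySimplyConnectedSpace X.carrier :=
  semilocallySimplyConnectedSpace_of_isLocalHomeomorph X.isLocalHomeomorph_proj

/-- The universal cover of an endless space, which is again an endless space. -/
noncomputable def universalCover : EndlessSpace.{u} P where
  carrier := UniversalCover X.base
  proj := X.proj ∘ UniversalCover.proj
  isLocalHomeomorph_proj := X.isLocalHomeomorph_proj.comp UniversalCover.isLocalHomeomorph_proj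
  base := .base X.base
  proj_base := X.proj_base
  exists_lift T γ h := by
    obtain ⟨Γ, hΓ, h0, hproj⟩ := X.exists_lift T γ h
    obtain ⟨Γ', hΓ', h0', hproj'⟩ := UniversalCover.exists_continuousOn_lift (P.nonneg h) hΓ h0
    exact ⟨Γ', hΓ', h0', fun t ht => (congrArg X.proj (hproj' t ht)).trans (hproj t ht)⟩

theorem isMorphism_universalCover_proj :
    IsMorphism X.universalCover X (UniversalCover.proj (b := X.base)) where
  continuous := UniversalCover.isLocalHomeomorph_proj.continuous
  map_base := rfl
  proj_comp := rfl

variable {X}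

theorem IsCofinal.simplyConnectedSpace (hX : X.IsCofinal) : SimplyConnectedSpace X.carrier := by
  obtain ⟨s, hs⟩ := hX X.universalCover
  exact UniversalCover.simplyConnectedSpace_of_section hs.continuous
    (congrFun (hs.comp_eq_id X.isMorphism_universalCover_proj)) hs.map_base

end UniversalCover

section lift

variable {T : ℝ} {γ : ℝ → E}

variable (Y) in
/-- The lift of an allowed path, starting at the base point. -/
noncomputable def lift (h : P.IsAllowed T γ) : ℝ → Y.carrier :=
  (Y.exists_lift T γ h).choose

variable (h : P.IsAllowed T γ)

theorem continuousOn_lift : ContinuousOn (Y.lift h) (Icc 0 T) :=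
  (Y.exists_lift T γ h).choose_spec.1

theorem lift_zero : Y.lift h 0 = Y.base :=
  (Y.exists_lift T γ h).choose_spec.2.1

theorem proj_lift {t : ℝ} (ht : t ∈ Icc 0 T) : Y.proj (Y.lift h t) = γ t :=
  (Y.exists_lift T γ h).choose_spec.2.2 t ht

theorem eqOn_lift {Γ : ℝ → Y.carrier} (hΓ : ContinuousOn Γ (Icc 0 T)) (h0 : Γ 0 = Y.base)
    (hproj : ∀ t ∈ Icc 0 T, Y.proj (Γ t) = γ t) : EqOn Γ (Y.lift h) (Icc 0 T) :=
  eqOn_of_proj_eqOn isPreconnected_Icc hΓ (continuousOn_lift h)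
    (fun t ht => (hproj t ht).trans (proj_lift h ht).symm) (left_mem_Icc.2 (P.nonneg h))
    (h0.trans (lift_zero h).symm)

theorem lift_truncate {t : ℝ} (ht : t ∈ Icc 0 T) :
    Y.lift (P.truncate h ht) t = Y.lift h t := by
  have hsub : Icc 0 t ⊆ Icc 0 T := Icc_subset_Icc_right ht.2
  exact (eqOn_lift (P.truncate h ht) ((continuousOn_lift h).mono hsub) (lift_zero h)
    (fun s hs => proj_lift h (hsub hs)) (right_mem_Icc.2 ht.1)).symm

theorem lift_appendSegment_of_le {w : E} (h' : P.IsAllowed (T + 1) (appendSegment T γ w)) {t : ℝ}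
    (ht : t ∈ Icc 0 T) : Y.lift h' t = Y.lift h t := by
  have hsub : Icc 0 T ⊆ Icc 0 (T + 1) := Icc_subset_Icc_right (by linarith)
  refine eqOn_lift h ((continuousOn_lift h').mono hsub) (lift_zero h') (fun s hs => ?_) ht
  rw [proj_lift h' (hsub hs), appendSegment_of_le hs.2]

end lift

end EndlessSpace

/-! ### The universal endless space -/

namespace PathClass

open EndlessSpace

variable {E : Type v} [NormedAddCommGroup E] [NormedSpace ℝ E] {P : PathClass E}

/-- An allowed path, bundled with its parameter interval `[0, time]`; the bundle lives in the
universe of the endless spaces. -/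
structure AllowedPath (P : PathClass E) : Type max u v where
  time : ℝ
  toFun : ℝ → E
  isAllowed : P.IsAllowed time toFun

namespace AllowedPath

variable (α : AllowedPath.{u} P) (Y : EndlessSpace.{u} P)

/-- The end point of an allowed path. -/
def endpoint : E := α.toFun α.time

/-- The end point of the lift of an allowed path to an endless space. -/
noncomputable def liftEndpoint : Y.carrier := Y.lift α.isAllowed α.time

theorem time_mem : α.time ∈ Icc 0 α.time := right_mem_Icc.2 (P.nonneg α.isAllowed)

theorem proj_liftEndpoint : Y.proj (α.liftEndpoint Y) = α.endpoint := proj_lift _ α.time_mem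

/-- The points to which an allowed path can be continued along a segment. -/
def reachableSet : Set E := {w | P.IsAllowed (α.time + 1) (appendSegment α.time α.toFun w)}

theorem reachableSet_mem_nhds : α.reachableSet ∈ 𝓝 α.endpoint :=
  P.eventually_appendSegment α.isAllowed

open Classical in
/-- The path `α` followed by the segment from its end point to `w`. The value is junk if this path
is not allowed. -/
noncomputable def append (w : E) : AllowedPath.{u} P :=
  if h : w ∈ α.reachableSet then ⟨α.time + 1, appendSegment α.time α.toFun w, h⟩ else α

variable {α} {w : E}

theorem append_of_mem (hw : w ∈ α.reachableSet) :
    α.append w = ⟨α.time + 1, appendSegment α.time α.toFun w, hw⟩ :=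
  dif_pos hw

theorem endpoint_append (hw : w ∈ α.reachableSet) : (α.append w).endpoint = w := by
  rw [append_of_mem hw]
  exact appendSegment_end

/-- The lifts of the segments from the end point of `α`, as a function of two variables. -/
noncomputable def segmentLift (x : unitInterval × α.reachableSet) : Y.carrier :=
  Y.lift x.2.2 (α.time + x.1)

theorem time_add_mem (t : unitInterval) : α.time + t ∈ Icc 0 (α.time + 1) :=
  ⟨add_nonneg (P.nonneg α.isAllowed) t.2.1, by gcongr; exact t.2.2⟩

theorem segmentLift_zero (w : α.reachableSet) :
    segmentLift Y (0, w) = α.liftEndpoint Y := by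
  simp only [segmentLift, Icc.coe_zero, add_zero]
  exact lift_appendSegment_of_le α.isAllowed _ α.time_mem

theorem segmentLift_one (w : α.reachableSet) :
    segmentLift Y (1, w) = (α.append w).liftEndpoint Y := by
  rw [append_of_mem w.2]
  rfl

theorem proj_segmentLift (x : unitInterval × α.reachableSet) :
    Y.proj (segmentLift Y x) = AffineMap.lineMap α.endpoint (x.2 : E) (x.1 : ℝ) := by
  refine (proj_lift x.2.2 (time_add_mem x.1)).trans ?_
  rw [appendSegment_of_ge (by linarith [x.1.2.1]), add_sub_cancel_left, endpoint]

theorem continuous_segmentLift : Continuous (segmentLift (α := α) Y) := by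
  have hline : Continuous fun x : unitInterval × α.reachableSet =>
      AffineMap.lineMap (k := ℝ) α.endpoint (x.2 : E) (x.1 : ℝ) := by
    simp only [AffineMap.lineMap_apply_module]
    fun_prop
  refine Y.isLocalHomeomorph_proj.continuous_lift (T2Space.isSeparatedMap _) ⟨_, hline⟩
    (funext (proj_segmentLift Y)) ?_ fun w => ?_
  · simp only [segmentLift_zero]
    exact continuous_const
  · exact (continuousOn_lift w.2).comp_continuous (by fun_prop) time_add_mem

variable (α) in
theorem continuousOn_liftEndpoint_append :
    ContinuousOn (fun w => (α.append w).liftEndpoint Y) α.reachableSet := by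
  rw [continuousOn_iff_continuous_domRestrict]
  exact ((continuous_segmentLift Y).comp (.prodMk_right 1)).congr (segmentLift_one Y)

variable (α) in
theorem liftEndpoint_append_endpoint :
    (α.append α.endpoint).liftEndpoint Y = α.liftEndpoint Y := by
  let w : α.reachableSet := ⟨α.endpoint, mem_of_mem_nhds α.reachableSet_mem_nhds⟩
  have hconst : EqOn (fun t => segmentLift Y (t, w)) (fun _ => α.liftEndpoint Y) univ := by
    refine eqOn_of_proj_eqOn isPreconnected_univ
      ((continuous_segmentLift Y).comp (.prodMk_left w)).continuousOn continuousOn_const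
      (fun t _ => ?_) (mem_univ 0) (segmentLift_zero Y w)
    rw [Function.comp_apply, Function.comp_apply, proj_segmentLift, proj_liftEndpoint,
      AffineMap.lineMap_same_apply]
  exact (segmentLift_one Y w).symm.trans (hconst (mem_univ 1))

/-- Two allowed paths are equivalent if they have the same end point, and their lifts to every
endless space have the same end point. -/
def setoid (P : PathClass E) : Setoid (AllowedPath.{u} P) where
  r α β := α.endpoint = β.endpoint ∧
    ∀ Y : EndlessSpace.{u} P, α.liftEndpoint Y = β.liftEndpoint Y
  iseqv :=
    ⟨fun _ => ⟨rfl, fun _ => rfl⟩, fun h => ⟨h.1.symm, fun Y => (h.2 Y).symm⟩,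
      fun h h' => ⟨h.1.trans h'.1, fun Y => (h.2 Y).trans (h'.2 Y)⟩⟩

end AllowedPath

/-- The points of the universal endless space: allowed paths up to equivalence. -/
def UniversalCarrier (P : PathClass E) : Type max u v := Quotient (AllowedPath.setoid.{u} P)

namespace UniversalCarrier

/-- The class of an allowed path. -/
def mk (α : AllowedPath.{u} P) : UniversalCarrier.{u} P := Quotient.mk _ α

/-- The projection of a class of allowed paths: the common end point. -/
def proj : UniversalCarrier.{u} P → E := Quotient.lift (fun α => α.endpoint) fun _ _ h => h.1

/-- The map to an endless space given by lifting allowed paths. -/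
noncomputable def toSpace (Y : EndlessSpace.{u} P) : UniversalCarrier.{u} P → Y.carrier :=
  Quotient.lift (fun α => α.liftEndpoint Y) fun _ _ h => h.2 Y

/-- An allowed path in a given class. -/
noncomputable def out (x : UniversalCarrier.{u} P) : AllowedPath.{u} P := Quotient.out x

theorem mk_out (x : UniversalCarrier.{u} P) : mk x.out = x := Quotient.out_eq x

theorem endpoint_out (x : UniversalCarrier.{u} P) : x.out.endpoint = proj x :=
  congrArg proj x.mk_out

theorem liftEndpoint_out (Y : EndlessSpace.{u} P) (x : UniversalCarrier.{u} P) :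
    x.out.liftEndpoint Y = toSpace Y x :=
  congrArg (toSpace Y) x.mk_out

theorem ext {x y : UniversalCarrier.{u} P} (h : proj x = proj y)
    (h' : ∀ Y, toSpace Y x = toSpace Y y) : x = y := by
  rw [← x.mk_out, ← y.mk_out]
  refine Quotient.sound ⟨?_, fun Y => ?_⟩
  · rw [endpoint_out, endpoint_out, h]
  · rw [liftEndpoint_out, liftEndpoint_out, h']

theorem proj_toSpace (Y : EndlessSpace.{u} P) (x : UniversalCarrier.{u} P) :
    Y.proj (toSpace Y x) = proj x := by
  rw [← endpoint_out, ← liftEndpoint_out, AllowedPath.proj_liftEndpoint]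

/-- The germ of section through a point, obtained by following segments. -/
noncomputable def germ (x : UniversalCarrier.{u} P) (w : E) : UniversalCarrier.{u} P :=
  mk (x.out.append w)

theorem toSpace_germ (Y : EndlessSpace.{u} P) (x : UniversalCarrier.{u} P) (w : E) :
    toSpace Y (germ x w) = (x.out.append w).liftEndpoint Y := rfl

theorem exists_ball_germ (x : UniversalCarrier.{u} P) :
    ∃ r > 0, (∀ w ∈ Metric.ball (proj x) r, proj (germ x w) = w) ∧
      ∀ Y, ContinuousOn (fun w => toSpace Y (germ x w)) (Metric.ball (proj x) r) := by
  obtain ⟨r, hr, hball⟩ := Metric.mem_nhds_iff.1 x.out.reachableSet_mem_nhds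
  rw [endpoint_out] at hball
  exact ⟨r, hr, fun w hw => AllowedPath.endpoint_append (hball hw),
    fun Y => (x.out.continuousOn_liftEndpoint_append Y).mono hball⟩

theorem germ_proj_self (x : UniversalCarrier.{u} P) : germ x (proj x) = x := by
  obtain ⟨r, hr, hproj, -⟩ := exists_ball_germ x
  refine ext (hproj _ (Metric.mem_ball_self hr)) fun Y => ?_
  rw [toSpace_germ, ← endpoint_out, AllowedPath.liftEndpoint_append_endpoint, liftEndpoint_out]

theorem eqOn_germ {x : UniversalCarrier.{u} P} {r : ℝ}
    (hproj : ∀ w ∈ Metric.ball (proj x) r, proj (germ x w) = w)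
    (hcont : ∀ Y, ContinuousOn (fun w => toSpace Y (germ x w)) (Metric.ball (proj x) r))
    {A : Type*} [TopologicalSpace A] {S : Set A} (hS : IsPreconnected S)
    {f : A → UniversalCarrier.{u} P} (hf : ∀ Y, ContinuousOn (toSpace Y ∘ f) S)
    (hpf : ContinuousOn (proj ∘ f) S) (hfS : MapsTo (proj ∘ f) S (Metric.ball (proj x) r))
    {a : A} (ha : a ∈ S) (hfa : f a = germ x (proj (f a))) :
    EqOn f (fun b => germ x (proj (f b))) S := by
  refine fun b hb => ext (hproj _ (hfS hb)).symm fun Y => ?_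
  refine eqOn_of_proj_eqOn hS (hf Y) ((hcont Y).comp hpf hfS) (fun c hc => ?_) ha
    (congrArg (toSpace Y) hfa) hb
  simp only [Function.comp_apply, proj_toSpace]
  exact (hproj _ (hfS hc)).symm

theorem isGermFamily_germ : IsGermFamily (proj (P := P)) germ.{u} where
  self := germ_proj_self
  proj x := by
    obtain ⟨r, hr, hproj, -⟩ := exists_ball_germ x
    exact mem_of_superset (Metric.ball_mem_nhds _ hr) hproj
  coherent x := by
    obtain ⟨r, hr, hproj, hcont⟩ := exists_ball_germ x
    filter_upwards [Metric.ball_mem_nhds _ hr] with w hw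
    obtain ⟨r', hr', hproj', hcont'⟩ := exists_ball_germ (germ x w)
    have hself := germ_proj_self (germ x w)
    rw [hproj w hw] at hproj' hcont' hself
    filter_upwards [Metric.ball_mem_nhds w hr', Metric.isOpen_ball.mem_nhds hw] with v hv' hv
    have hid : EqOn (proj ∘ germ (germ x w)) id (Metric.ball w r' ∩ Metric.ball (proj x) r) :=
      fun z hz => hproj' z hz.1
    have heq := eqOn_germ hproj hcont
      ((convex_ball w r').inter (convex_ball (proj x) r)).isPreconnected
      (fun Y => (hcont' Y).mono inter_subset_left) (continuousOn_id.congr hid)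
      (hid.mapsTo_iff.2 fun z hz => hz.2) ⟨Metric.mem_ball_self hr', hw⟩
      (by rw [hself, hproj w hw]) ⟨hv', hv⟩
    exact heq.trans (congrArg (germ x) (hproj' v hv'))

noncomputable instance : TopologicalSpace (UniversalCarrier.{u} P) := etaleTopology proj germ

theorem isLocalHomeomorph_proj : IsLocalHomeomorph (proj.{u} (P := P)) :=
  isGermFamily_germ.{u}.isLocalHomeomorph

theorem continuous_toSpace (Y : EndlessSpace.{u} P) : Continuous (toSpace Y) := by
  refine continuous_iff_continuousAt.2 fun x => isGermFamily_germ.continuousAt_iff.2 ?_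
  obtain ⟨r, hr, -, hcont⟩ := exists_ball_germ x
  have h := ((hcont Y).continuousAt (Metric.ball_mem_nhds _ hr)).tendsto
  rwa [germ_proj_self] at h

instance : T2Space (UniversalCarrier.{u} P) := by
  refine ⟨fun x y hxy => ?_⟩
  by_cases h : proj x = proj y
  · obtain ⟨Y, hY⟩ : ∃ Y, toSpace Y x ≠ toSpace Y y := by
      by_contra! h'
      exact hxy (ext h h')
    exact separated_by_continuous (continuous_toSpace Y) hY
  · exact separated_by_continuous isLocalHomeomorph_proj.continuous h

/-- The class of the constant path. -/
def base (P : PathClass E) : UniversalCarrier.{u} P := mk ⟨0, _, P.isAllowed_const⟩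

theorem toSpace_base (Y : EndlessSpace.{u} P) : toSpace Y (base P) = Y.base :=
  lift_zero P.isAllowed_const

section pathLift

variable {T : ℝ} {γ : ℝ → E} (h : P.IsAllowed T γ)

open Classical in
/-- The lift of an allowed path, given by the classes of its truncations. -/
noncomputable def pathLift (t : ℝ) : UniversalCarrier.{u} P :=
  if ht : t ∈ Icc 0 T then mk ⟨t, γ, P.truncate h ht⟩ else base P

theorem pathLift_of_mem {t : ℝ} (ht : t ∈ Icc 0 T) :
    pathLift.{u} h t = mk ⟨t, γ, P.truncate h ht⟩ := dif_pos ht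

theorem proj_pathLift {t : ℝ} (ht : t ∈ Icc 0 T) : proj (pathLift.{u} h t) = γ t := by
  rw [pathLift_of_mem h ht]
  rfl

theorem toSpace_pathLift (Y : EndlessSpace.{u} P) {t : ℝ} (ht : t ∈ Icc 0 T) :
    toSpace Y (pathLift h t) = Y.lift h t := by
  rw [pathLift_of_mem h ht]
  exact lift_truncate h ht

theorem pathLift_zero : pathLift.{u} h 0 = base P := by
  have h0 : (0 : ℝ) ∈ Icc 0 T := left_mem_Icc.2 (P.nonneg h)
  refine ext ((proj_pathLift h h0).trans (P.apply_zero h)) fun Y => ?_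
  rw [toSpace_pathLift h Y h0, lift_zero, toSpace_base]

theorem continuousOn_pathLift : ContinuousOn (pathLift.{u} h) (Icc 0 T) := by
  intro t₀ ht₀
  have hproj : ContinuousOn (proj ∘ pathLift.{u} h) (Icc 0 T) :=
    (P.continuousOn h).congr fun t ht => proj_pathLift h ht
  refine isGermFamily_germ.continuousWithinAt (hproj t₀ ht₀) ?_
  obtain ⟨r, hr, hball⟩ := exists_ball_germ (pathLift.{u} h t₀)
  obtain ⟨δ, hδ, hmaps⟩ :=
    Metric.mem_nhdsWithin_iff.1 (hproj t₀ ht₀ (Metric.ball_mem_nhds _ hr))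
  filter_upwards [inter_mem_nhdsWithin _ (Metric.ball_mem_nhds t₀ hδ)] with t ht
  exact eqOn_germ hball.1 hball.2 ((convex_Icc 0 T).inter (convex_ball t₀ δ)).isPreconnected
    (fun Y => ((continuousOn_lift h).congr fun s hs => toSpace_pathLift h Y hs).mono
      inter_subset_left)
    (hproj.mono inter_subset_left) (fun s hs => hmaps hs.symm) ⟨ht₀, Metric.mem_ball_self hδ⟩
    (germ_proj_self _).symm ht

end pathLift

instance : ConnectedSpace (UniversalCarrier.{u} P) where
  toPreconnectedSpace := by
    refine ⟨isPreconnected_of_forall (base P) fun x _ => ?_⟩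
    let T := x.out.time
    have h := x.out.isAllowed
    refine ⟨pathLift h '' Icc 0 T, subset_univ _,
      ⟨0, left_mem_Icc.2 (P.nonneg h), pathLift_zero h⟩, ⟨T, x.out.time_mem, ?_⟩,
      isPreconnected_Icc.image _ (continuousOn_pathLift h)⟩
    exact (pathLift_of_mem h x.out.time_mem).trans x.mk_out
  toNonempty := ⟨base P⟩

end UniversalCarrier

/-- The universal endless space for a class of paths. -/
noncomputable def universalSpace (P : PathClass E) : EndlessSpace.{u} P where
  carrier := UniversalCarrier.{u} P
  proj := UniversalCarrier.proj
  isLocalHomeomorph_proj := UniversalCarrier.isLocalHomeomorph_proj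
  base := UniversalCarrier.base P
  proj_base := rfl
  exists_lift _ _ h := ⟨UniversalCarrier.pathLift h, UniversalCarrier.continuousOn_pathLift h,
    UniversalCarrier.pathLift_zero h, fun _ => UniversalCarrier.proj_pathLift h⟩

theorem isCofinal_universalSpace (P : PathClass E) : (universalSpace.{u} P).IsCofinal := fun Y =>
  ⟨UniversalCarrier.toSpace Y, UniversalCarrier.continuous_toSpace Y,
    UniversalCarrier.toSpace_base Y, funext (UniversalCarrier.proj_toSpace Y)⟩

end PathClass

theorem proposition2_general {E : Type v} [NormedAddCommGroup E] [NormedSpace ℝ E]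
    (P : PathClass E) :
    ∃ X : EndlessSpace.{u} P,
      X.IsCofinal ∧
      (∀ Y : EndlessSpace.{u} P, Y.IsCofinal →
        ∃ Φ : X.carrier ≃ₜ Y.carrier, EndlessSpace.IsMorphism X Y Φ) ∧
      SimplyConnectedSpace X.carrier :=
  have hX := P.isCofinal_universalSpace
  ⟨P.universalSpace, hX, fun _ hY => hX.exists_homeomorph hY, hX.simplyConnectedSpace⟩

/-! ### Lengths of paths -/

theorem eVariationOn_Icc_le_of_lipschitzOnWith {E : Type*} [PseudoEMetricSpace E] {f : ℝ → E}
    {K : ℝ≥0} {a b : ℝ} (hf : LipschitzOnWith K f (Icc a b)) :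
    eVariationOn f (Icc a b) ≤ K * ENNReal.ofReal (b - a) := by
  rcases lt_or_ge b a with hab | hab
  · simp [Icc_eq_empty hab.not_ge, eVariationOn]
  refine (hf.comp_eVariationOn_le (g := id) (mapsTo_id _)).trans ?_
  gcongr
  have := (monotoneOn_id (s := Icc a b)).eVariationOn_eq (left_mem_Icc.2 hab)
    (right_mem_Icc.2 hab)
  rw [inter_self] at this
  exact this.le

section appendSegment

variable {E : Type*} [NormedAddCommGroup E] [NormedSpace ℝ E] {T : ℝ} {γ : ℝ → E} {w : E} {t : ℝ}

theorem lipschitzOnWith_appendSegment {K : ℝ≥0} (hγ : LipschitzOnWith K γ (Icc 0 T))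
    (hT : 0 ≤ T) : LipschitzOnWith (K + ‖w - γ T‖₊) (appendSegment T γ w) (Icc 0 (T + 1)) := by
  refine LipschitzOnWith.of_dist_le_mul fun s hs t ht => ?_
  have hpath : dist (γ (min s T)) (γ (min t T)) ≤ K * dist s t := by
    refine (hγ.dist_le_mul _ ⟨le_min hs.1 hT, min_le_right _ _⟩ _
      ⟨le_min ht.1 hT, min_le_right _ _⟩).trans ?_
    gcongr
    simpa [Real.dist_eq] using abs_min_sub_min_le_max s T t T
  have hsegment : dist (max (s - T) 0 • (w - γ T)) (max (t - T) 0 • (w - γ T)) ≤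
      ‖w - γ T‖₊ * dist s t := by
    rw [dist_eq_norm, ← sub_smul, norm_smul, mul_comm, coe_nnnorm]
    gcongr
    rw [Real.norm_eq_abs, Real.dist_eq]
    simpa using abs_max_sub_max_le_max (s - T) 0 (t - T) 0
  calc dist (appendSegment T γ w s) (appendSegment T γ w t)
      ≤ dist (γ (min s T)) (γ (min t T)) +
          dist (max (s - T) 0 • (w - γ T)) (max (t - T) 0 • (w - γ T)) :=
        dist_add_add_le _ _ _ _
    _ ≤ K * dist s t + ‖w - γ T‖₊ * dist s t := add_le_add hpath hsegment
    _ = ↑(K + ‖w - γ T‖₊) * dist s t := by rw [NNReal.coe_add, add_mul]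

theorem eVariationOn_appendSegment_le (ht : t ≤ T + 1) :
    eVariationOn (appendSegment T γ w) (Icc T t) ≤ ‖w - γ T‖₊ := by
  have hlip : LipschitzOnWith ‖w - γ T‖₊ (appendSegment T γ w) (Icc T t) := by
    refine LipschitzOnWith.of_dist_le_mul fun s hs r hr => ?_
    rw [appendSegment_of_ge hs.1, appendSegment_of_ge hr.1, dist_lineMap_lineMap, mul_comm,
      dist_comm (γ T), dist_eq_norm w, coe_nnnorm, dist_sub_right]
  calc eVariationOn (appendSegment T γ w) (Icc T t)
      ≤ ‖w - γ T‖₊ * ENNReal.ofReal (t - T) := eVariationOn_Icc_le_of_lipschitzOnWith hlip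
    _ ≤ ‖w - γ T‖₊ * 1 := by
        gcongr
        exact ENNReal.ofReal_le_one.2 (by linarith)
    _ = ‖w - γ T‖₊ := mul_one _

theorem dist_appendSegment_le (ht : t ∈ Icc T (T + 1)) :
    dist (appendSegment T γ w t) (γ T) ≤ dist w (γ T) := by
  rw [appendSegment_of_ge ht.1, dist_lineMap_left, dist_comm w]
  refine mul_le_of_le_one_left dist_nonneg ?_
  rw [Real.norm_eq_abs, abs_of_nonneg (by linarith [ht.1])]
  linarith [ht.2]

end appendSegment

namespace DiscreteFilteredSet

section pathLength

variable {T : ℝ} {γ : ℝ → ℂ} {w : ℂ} {t : ℝ}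

theorem pathLength_zero (γ : ℝ → ℂ) : pathLength γ 0 = 0 := by
  rw [pathLength, eVariationOn.subsingleton _ (by simp)]
  rfl

theorem pathLength_appendSegment_of_le (ht : t ≤ T) :
    pathLength (appendSegment T γ w) t = pathLength γ t := by
  rw [pathLength, pathLength, eVariationOn.eq_of_eqOn]
  exact fun s hs => appendSegment_of_le (hs.2.trans ht)

theorem dist_pathLength_appendSegment_le {K : ℝ≥0} (hγ : LipschitzOnWith K γ (Icc 0 T))
    (hT : 0 ≤ T) (ht : t ∈ Icc T (T + 1)) :
    dist (pathLength (appendSegment T γ w) t) (pathLength γ T) ≤ dist w (γ T) := by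
  have hadd : eVariationOn (appendSegment T γ w) (Icc 0 t) =
      eVariationOn γ (Icc 0 T) + eVariationOn (appendSegment T γ w) (Icc T t) := by
    have := eVariationOn.Icc_add_Icc (appendSegment T γ w) (s := univ) hT ht.1 (mem_univ _)
    simp only [univ_inter] at this
    rw [← this, eVariationOn.eq_of_eqOn (f := appendSegment T γ w) (f' := γ) (s := Icc 0 T)
      fun s hs => appendSegment_of_le hs.2]
  have hle := eVariationOn_appendSegment_le (γ := γ) (w := w) ht.2
  have hγ_top : eVariationOn γ (Icc 0 T) ≠ ⊤ :=
    ne_top_of_le_ne_top (by finiteness) (eVariationOn_Icc_le_of_lipschitzOnWith hγ)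
  have hsegment_top : eVariationOn (appendSegment T γ w) (Icc T t) ≠ ⊤ :=
    ne_top_of_le_ne_top (by finiteness) hle
  rw [pathLength, pathLength, hadd, ENNReal.toNNReal_add hγ_top hsegment_top, NNReal.dist_eq,
    NNReal.coe_add, add_sub_cancel_left, abs_of_nonneg NNReal.zero_le_coe, dist_eq_norm,
    ← coe_nnnorm, NNReal.coe_le_coe]
  exact (ENNReal.toNNReal_mono ENNReal.coe_ne_top hle).trans_eq (ENNReal.toNNReal_coe _)

end pathLength

variable {Ω : DiscreteFilteredSet} {T : ℝ} {γ : ℝ → ℂ}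

theorem isOpen_allowedSet : IsOpen Ω.allowedSet := isClosed_closure.isOpen_compl

theorem zero_mem_allowedSet : (0, 0) ∈ Ω.allowedSet := by
  obtain ⟨δ, hδ, hΩ⟩ := Ω.exists_level_eq_empty
  intro h
  obtain ⟨x, hx, hxS⟩ := mem_closure_iff_nhds.1 h (Iio δ ×ˢ univ)
    (prod_mem_nhds (Iio_mem_nhds hδ) univ_mem)
  have hmem := Ω.level_subset _ _ (le_of_lt hx.1) hxS
  rwa [hΩ] at hmem

theorem isAllowedPath_const_zero : Ω.IsAllowedPath 0 fun _ => 0 where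
  nonneg := le_rfl
  lipschitz := ⟨0, (LipschitzWith.const 0).lipschitzOnWith⟩
  start := rfl
  mem_allowedSet t ht := by
    rw [Icc_self, mem_singleton_iff] at ht
    rw [ht, pathLength_zero]
    exact zero_mem_allowedSet

namespace IsAllowedPath

theorem truncate (h : Ω.IsAllowedPath T γ) {t : ℝ} (ht : t ∈ Icc 0 T) :
    Ω.IsAllowedPath t γ where
  nonneg := ht.1
  lipschitz := h.lipschitz.imp fun _ hK => hK.mono (Icc_subset_Icc_right ht.2)
  start := h.start
  mem_allowedSet s hs := h.mem_allowedSet s ⟨hs.1, hs.2.trans ht.2⟩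

theorem eventually_appendSegment (h : Ω.IsAllowedPath T γ) :
    ∀ᶠ w in 𝓝 (γ T), Ω.IsAllowedPath (T + 1) (appendSegment T γ w) := by
  obtain ⟨r, hr, hball⟩ := Metric.isOpen_iff.1 isOpen_allowedSet _
    (h.mem_allowedSet T (right_mem_Icc.2 h.nonneg))
  obtain ⟨K, hK⟩ := h.lipschitz
  filter_upwards [Metric.ball_mem_nhds _ hr] with w hw
  refine ⟨by linarith [h.nonneg], ⟨_, lipschitzOnWith_appendSegment hK h.nonneg⟩, ?_,
    fun t ht => ?_⟩
  · rw [appendSegment_of_le h.nonneg, h.start]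
  rcases le_total t T with htT | htT
  · rw [appendSegment_of_le htT, pathLength_appendSegment_of_le htT]
    exact h.mem_allowedSet t ⟨ht.1, htT⟩
  · have ht' : t ∈ Icc T (T + 1) := ⟨htT, ht.2⟩
    exact hball (max_lt ((dist_pathLength_appendSegment_le hK h.nonneg ht').trans_lt hw)
      ((dist_appendSegment_le ht').trans_lt hw))

end IsAllowedPath

/-- The class of `Ω`-allowed paths. -/
def allowedPaths (Ω : DiscreteFilteredSet) : PathClass ℂ where
  IsAllowed := Ω.IsAllowedPath
  origin := 0
  nonneg := IsAllowedPath.nonneg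
  continuousOn h := h.lipschitz.choose_spec.continuousOn
  apply_zero := IsAllowedPath.start
  isAllowed_const := isAllowedPath_const_zero
  truncate h ht := h.truncate ht
  eventually_appendSegment := IsAllowedPath.eventually_appendSegment

end DiscreteFilteredSet

/-! ### Riemann surfaces from local homeomorphisms -/

section LocalDiffeomorph

variable {𝕜 : Type*} [NontriviallyNormedField 𝕜] {E F G : Type*} [NormedAddCommGroup E]
  [NormedSpace 𝕜 E] [NormedAddCommGroup F] [NormedSpace 𝕜 F] [NormedAddCommGroup G]
  [NormedSpace 𝕜 G] {H K L : Type*} [TopologicalSpace H] [TopologicalSpace K] [TopologicalSpace L]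
  (I : ModelWithCorners 𝕜 E H) {J : ModelWithCorners 𝕜 F K} {I' : ModelWithCorners 𝕜 G L}
  {M N P : Type*} [TopologicalSpace M] (n : ℕ∞ω)

theorem isManifold_of_isLocalHomeomorph {p : M → H} (hp : IsLocalHomeomorph p) :
    letI := chartedSpaceOfIsLocalHomeomorph hp; IsManifold I n M := by
  let := chartedSpaceOfIsLocalHomeomorph hp
  refine isManifold_of_contDiffOn I n M fun e e' he he' => contDiffOn_id.congr fun z hz => ?_
  have he : p = e := he
  have he' : p = e' := he'
  simp only [mfld_simps] at hz ⊢
  rw [← he', he, e.right_inv hz.1.1, I.right_inv hz.2]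

theorem isLocalDiffeomorph_of_isLocalHomeomorph {p : M → H} (hp : IsLocalHomeomorph p) :
    letI := chartedSpaceOfIsLocalHomeomorph hp; IsLocalDiffeomorph I I n p := by
  let := chartedSpaceOfIsLocalHomeomorph hp
  have := isManifold_of_isLocalHomeomorph I n hp
  intro x
  have hmem := IsManifold.chart_mem_maximalAtlas (I := I) (n := n) x
  exact ⟨⟨(chartAt H x).toPartialEquiv, (chartAt H x).open_source, (chartAt H x).open_target,
    contMDiffOn_of_mem_maximalAtlas hmem, contMDiffOn_symm_of_mem_maximalAtlas hmem⟩,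
    mem_chart_source H x, fun y _ => congrFun (hp x).choose_spec.2 y⟩

variable {I n} [ChartedSpace H M] [TopologicalSpace N] [ChartedSpace K N]

theorem isLocalDiffeomorphAt_of_eventuallyEq {f g : M → N} {x : M}
    (hf : IsLocalDiffeomorphAt I J n f x) (hfg : g =ᶠ[𝓝 x] f) :
    IsLocalDiffeomorphAt I J n g x := by
  obtain ⟨Φ, hx, hΦ⟩ := hf
  obtain ⟨U, hU, hUo, hxU⟩ := eventually_nhds_iff.1 hfg
  let e := Φ.toOpenPartialHomeomorph.restrOpen U hUo
  exact ⟨⟨e.toPartialEquiv, e.open_source, e.open_target,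
    Φ.contMDiffOn_toFun.mono inter_subset_left, Φ.contMDiffOn_invFun.mono inter_subset_left⟩,
    ⟨hx, hxU⟩, fun y hy => (hU y hy.2).trans (hΦ hy.1)⟩

theorem isLocalDiffeomorph_of_comp [TopologicalSpace P] [ChartedSpace L P] {f : M → N} {g : N → P}
    (hgf : IsLocalDiffeomorph I I' n (g ∘ f)) (hg : IsLocalDiffeomorph J I' n g)
    (hf : Continuous f) : IsLocalDiffeomorph I J n f := fun x =>
  isLocalDiffeomorphAt_of_eventuallyEq
    ((hgf x).comp J N (hg (f x)).localInverse_isLocalDiffeomorphAt)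
    (hf.continuousAt.eventually
      ((hg (f x)).localInverse_eventuallyEq_left.mono fun _ h => h.symm))

end LocalDiffeomorph

namespace EndlessRiemannSurface

variable {Ω : DiscreteFilteredSet} {X Y : EndlessRiemannSurface.{u} Ω}

/-- The endless space underlying an endless Riemann surface. -/
def toEndlessSpace (X : EndlessRiemannSurface.{u} Ω) : EndlessSpace.{u} Ω.allowedPaths where
  carrier := X.carrier
  proj := X.proj
  isLocalHomeomorph_proj := X.isLocalDiffeomorph_proj.isLocalHomeomorph
  base := X.base
  proj_base := X.proj_base
  exists_lift := X.exists_lift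

theorem isMorphism_toEndlessSpace_iff {q : X.carrier → Y.carrier} :
    EndlessSpace.IsMorphism X.toEndlessSpace Y.toEndlessSpace q ↔ X.IsMorphism Y q where
  mp h := ⟨isLocalDiffeomorph_of_comp (h.proj_comp.symm ▸ X.isLocalDiffeomorph_proj)
    Y.isLocalDiffeomorph_proj h.continuous, h.map_base, h.proj_comp⟩
  mpr h := ⟨h.isLocalDiffeomorph.contMDiff.continuous, h.map_base, h.proj_comp⟩

end EndlessRiemannSurface

namespace EndlessSpace

variable {Ω : DiscreteFilteredSet} {X Y : EndlessSpace.{u} Ω.allowedPaths}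

/-- The Riemann surface given by an endless space for `Ω`-allowed paths: its charts are the local
inverses of the projection. -/
noncomputable def toRiemannSurface (X : EndlessSpace.{u} Ω.allowedPaths) :
    EndlessRiemannSurface.{u} Ω :=
  let _ := chartedSpaceOfIsLocalHomeomorph X.isLocalHomeomorph_proj
  { carrier := X.carrier
    isManifold := isManifold_of_isLocalHomeomorph 𝓘(ℂ) ω X.isLocalHomeomorph_proj
    proj := X.proj
    isLocalDiffeomorph_proj :=
      isLocalDiffeomorph_of_isLocalHomeomorph 𝓘(ℂ) ω X.isLocalHomeomorph_proj
    base := X.base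
    proj_base := X.proj_base
    exists_lift := X.exists_lift }

theorem IsCofinal.toRiemannSurface (hX : X.IsCofinal) : X.toRiemannSurface.IsCofinal := fun Y =>
  (hX Y.toEndlessSpace).imp fun _ =>
    (EndlessRiemannSurface.isMorphism_toEndlessSpace_iff (X := X.toRiemannSurface)).1

end EndlessSpace

namespace EndlessRiemannSurface

variable {Ω : DiscreteFilteredSet} {X Y : EndlessRiemannSurface.{u} Ω}

theorem IsCofinal.toEndlessSpace (hX : X.IsCofinal) : X.toEndlessSpace.IsCofinal := fun Y =>
  (hX Y.toRiemannSurface).imp fun _ =>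
    (isMorphism_toEndlessSpace_iff (Y := Y.toRiemannSurface)).2

variable (X Y) in
theorem isIsomorphic_of_homeomorph (Φ : X.carrier ≃ₜ Y.carrier)
    (hΦ : EndlessSpace.IsMorphism X.toEndlessSpace Y.toEndlessSpace Φ) : X.IsIsomorphic Y := by
  have hsymm : EndlessSpace.IsMorphism Y.toEndlessSpace X.toEndlessSpace Φ.symm :=
    ⟨Φ.symm.continuous, Φ.symm_apply_eq.2 hΦ.map_base.symm,
      ((Φ.eq_comp_symm _ _).2 hΦ.proj_comp).symm⟩
  exact ⟨⟨Φ.toEquiv, (isMorphism_toEndlessSpace_iff.1 hΦ).isLocalDiffeomorph.contMDiff,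
    (isMorphism_toEndlessSpace_iff.1 hsymm).isLocalDiffeomorph.contMDiff⟩, hΦ.map_base,
    hΦ.proj_comp⟩

end EndlessRiemannSurface

theorem proposition2 (Ω : DiscreteFilteredSet) :
    ∃ X : EndlessRiemannSurface.{u} Ω,
      X.IsCofinal ∧
      (∀ Y : EndlessRiemannSurface.{u} Ω, Y.IsCofinal → X.IsIsomorphic Y) ∧
      SimplyConnectedSpace X.carrier := by
  obtain ⟨X, hX, hunique, hsc⟩ := proposition2_general Ω.allowedPaths
  exact ⟨X.toRiemannSurface, hX.toRiemannSurface, fun Y hY =>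
    (hunique _ hY.toEndlessSpace).elim (X.toRiemannSurface.isIsomorphic_of_homeomorph Y), hsc⟩
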